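/- Let $\varphi=(1+\sqrt5)/2$, and let $x_F=x_1x_2x_3\cdots=0100101001001\cdots$ be the infinite Fibonacci word, i.e. the iterative fixed point of the morphism $0\mapsto 01$, $1\mapsto 0$. Let $w$ be any finite word that occurs in $x_F$. Then $w$ occurs infinitely often in $x_F$; let $Y(1)<Y(2)<Y(3)<\cdots$ be all the positions of its occurrences, i.e. all $k\ge 1$ with $x_kx_{k+1}\cdots x_{k+|w|-1}=w$. Write $x_F=r_0(w)\,r_1(w)\,r_2(w)\cdots$, where $r_0(w)=x_1\cdots x_{Y(1)-1}$ is the (possibly empty) prefix before the first occurrence of $w$ and, for $i\ge1$, $r_i(w)=x_{Y(i)}\cdots x_{Y(i+1)-1}$ is the $i$-th return word of $w$. Put $l_1=|r_1(w)|$ and $l_2=|r_2(w)|$. Then $Y$ is a generalized Beatty sequence: for all $n\ge 1$, $$Y(n)=p\lfloor n\varphi\rfloor+qn+r,\qquad p=l_1-l_2,\quad q=2l_2-l_1,\quad r=|r_0(w)|+1-l_2 .$$ -/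

import Mathlib

namespace FibReturn

/-- The Fibonacci morphism `0 ↦ 01`, `1 ↦ 0` on letters. -/
def morphismLetter (a : Fin 2) : List (Fin 2) :=
  if a = 0 then [0, 1] else [0]

/-- The Fibonacci morphism on finite words. -/
def morphism (u : List (Fin 2)) : List (Fin 2) :=
  u.flatMap morphismLetter

/-- The `k`-th iterate of the Fibonacci morphism, applied to the word `0`. -/
def iter (k : ℕ) : List (Fin 2) :=
  morphism^[k] [0]

/-- The letter at position `k ≥ 1` of the infinite Fibonacci word `x₁ x₂ x₃ … = 0100101001001…`,
the iterative fixed point of the morphism: it is read off from the `k`-th iterate, which has at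
least `k` letters (`le_length_iter`) and is a prefix of all later iterates (`iter_prefix`).
Position `0` is not used. -/
def fibWord (k : ℕ) : Fin 2 :=
  (iter k).getD (k - 1) 0

theorem morphism_append (u v : List (Fin 2)) : morphism (u ++ v) = morphism u ++ morphism v := by
  simp [morphism]

theorem iter_succ (k : ℕ) : iter (k + 1) = morphism (iter k) := by
  simp [iter, Function.iterate_succ_apply']

theorem iter_add_two (k : ℕ) : iter (k + 2) = iter (k + 1) ++ iter k := by
  induction k with
  | zero => decide
  | succ k ih =>
    rw [iter_succ (k + 2), ih, morphism_append, ← iter_succ, ← iter_succ, ih]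

theorem iter_prefix (k : ℕ) : iter k <+: iter (k + 1) := by
  cases k with
  | zero => decide
  | succ k => rw [iter_add_two]; exact List.prefix_append _ _

theorem le_length_iter (k : ℕ) : k + 1 ≤ (iter k).length := by
  induction k using Nat.strong_induction_on with
  | _ k ih =>
    match k, ih with
    | 0, _ => decide
    | 1, _ => decide
    | k + 2, ih =>
      have h1 := ih (k + 1) (by omega)
      have h2 := ih k (by omega)
      rw [iter_add_two, List.length_append]
      omega

/-- The factor `x_k x_{k+1} … x_{k+m-1}` of length `m` of the Fibonacci word. -/
def factor (k m : ℕ) : List (Fin 2) :=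
  (List.range m).map fun i => fibWord (k + i)

/-- The word `w` occurs in the Fibonacci word at position `k`, where `k ≥ 1`. -/
def OccursAt (w : List (Fin 2)) (k : ℕ) : Prop :=
  1 ≤ k ∧ factor k w.length = w

/-- The Fibonacci language: all finite words that occur in the Fibonacci word. -/
def language : Set (List (Fin 2)) :=
  {w | ∃ k, OccursAt w k}

/-- The position `Y(n)` of the `n`-th occurrence of `w` in the Fibonacci word, `n = 1, 2, 3, …`,
in increasing order (meaningful as long as there are at least `n` occurrences). -/
noncomputable def position (w : List (Fin 2)) (n : ℕ) : ℕ :=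
  Nat.nth (OccursAt w) (n - 1)

/-- The return sequence `r₀(w), r₁(w), r₂(w), …` of `w`: the word `r₀(w)` is the prefix of the
Fibonacci word that precedes the first occurrence of `w`, and for `n ≥ 1` the word `rₙ(w)` is the
return word that extends from the beginning of the `n`-th occurrence of `w` up to, and not
including, the beginning of the next one. -/
noncomputable def returnWord (w : List (Fin 2)) : ℕ → List (Fin 2)
  | 0 => factor 1 (position w 1 - 1)
  | n + 1 => factor (position w (n + 1)) (position w (n + 2) - position w (n + 1))

/-- `(V(n))_{n ≥ 1}` is the generalized Beatty sequence `p ⌊n α⌋ + q n + r`. -/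
def IsGeneralizedBeatty (α : ℝ) (p q r : ℤ) (V : ℕ → ℤ) : Prop :=
  ∀ n : ℕ, 1 ≤ n → V n = p * ⌊(n : ℝ) * α⌋ + q * (n : ℤ) + r

end FibReturn

namespace FibReturn

/-! ### The Fibonacci word as a fixed point -/

/-! The word is cut into blocks, the images `01` and `0` of its own letters. An occurrence of `w`
starting with 0 begins at a block boundary, so `w` desubstitutes to a shorter word `v` whose
occurrences correspond to those of `w` under `blockStart` (`exists_desubstitution`); an initial 1
forces a preceding 0. Since `blockStart m = m + zeros m` and `zeros (blockStart m) = m`, descent to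
the empty word makes the occurrence positions affine in `n` and `zeros n`. Finally
`floor_mul_goldenRatio` turns `zeros` into a floor, and the first three positions determine the
coefficients. -/

theorem iter_prefix_of_le {k m : ℕ} (h : k ≤ m) : iter k <+: iter m := by
  induction m, h using Nat.le_induction with
  | base => exact List.prefix_rfl
  | succ m _ ih => exact ih.trans (iter_prefix m)

theorem getElem?_iter {k j : ℕ} (h : j < (iter k).length) :
    (iter k)[j]? = some (fibWord (j + 1)) := by
  have hj : j < (iter (j + 1)).length := by have := le_length_iter (j + 1); omega
  have h1 : (iter (j + 1))[j]? = some (fibWord (j + 1)) := by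
    simp [fibWord, hj]
  rcases le_total k (j + 1) with hk | hk
  · obtain ⟨t, ht⟩ := iter_prefix_of_le hk
    rw [← h1, ← ht, List.getElem?_append_left h]
  · obtain ⟨t, ht⟩ := iter_prefix_of_le hk
    rw [← h1, ← ht, List.getElem?_append_left hj]

/-- The number of zeros among the first `n` letters of the Fibonacci word. -/
def zeros (n : ℕ) : ℕ :=
  Nat.count (fun j => fibWord (j + 1) = 0) n

/-- The length of the image under the morphism of the first `n` letters of the Fibonacci word. -/
def blockStart (n : ℕ) : ℕ := n + zeros n

theorem zeros_succ_of_zero {n : ℕ} (h : fibWord (n + 1) = 0) : zeros (n + 1) = zeros n + 1 := by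
  simp [zeros, Nat.count_succ, h]

theorem zeros_succ_of_one {n : ℕ} (h : fibWord (n + 1) = 1) : zeros (n + 1) = zeros n := by
  simp [zeros, Nat.count_succ, h]

theorem blockStart_succ_of_zero {n : ℕ} (h : fibWord (n + 1) = 0) :
    blockStart (n + 1) = blockStart n + 2 := by
  rw [blockStart, blockStart, zeros_succ_of_zero h]; omega

theorem blockStart_succ_of_one {n : ℕ} (h : fibWord (n + 1) = 1) :
    blockStart (n + 1) = blockStart n + 1 := by
  rw [blockStart, blockStart, zeros_succ_of_one h]; omega

theorem letter_cases (a : Fin 2) : a = 0 ∨ a = 1 := by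
  fin_cases a <;> simp

theorem length_morphism_take_iter {k n : ℕ} (h : n ≤ (iter k).length) :
    (morphism ((iter k).take n)).length = blockStart n := by
  induction n with
  | zero => simp [morphism, blockStart, zeros]
  | succ n ih =>
    rw [List.take_add_one, getElem?_iter h, morphism_append, List.length_append, ih (by omega)]
    rcases letter_cases (fibWord (n + 1)) with h0 | h0
    · rw [blockStart_succ_of_zero h0, h0]; rfl
    · rw [blockStart_succ_of_one h0, h0]; rfl

/-- The image of the letter at position `n + 1` begins after `blockStart n` letters. -/
theorem fibWord_block {n i : ℕ} (h : i < (morphismLetter (fibWord (n + 1))).length) :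
    (morphismLetter (fibWord (n + 1)))[i]? = some (fibWord (blockStart n + i + 1)) := by
  have hn : n < (iter n).length := le_length_iter n
  have hx : (iter n)[n] = fibWord (n + 1) := by
    have := getElem?_iter hn
    rwa [List.getElem?_eq_getElem hn, Option.some_inj] at this
  have hs : iter (n + 1) = morphism ((iter n).take n) ++
      (morphismLetter (fibWord (n + 1)) ++ morphism ((iter n).drop (n + 1))) := by
    rw [iter_succ]
    conv_lhs => rw [← List.take_append_drop n (iter n), List.drop_eq_getElem_cons hn, hx]
    rw [morphism_append]
    simp [morphism]
  have hl := length_morphism_take_iter hn.le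
  rw [← getElem?_iter (k := n + 1) (j := blockStart n + i), hs,
    List.getElem?_append_right (by omega), hl, Nat.add_sub_cancel_left,
    List.getElem?_append_left h]
  rw [hs, List.length_append, List.length_append, hl]
  omega

theorem fibWord_blockStart (n : ℕ) : fibWord (blockStart n + 1) = 0 := by
  have := fibWord_block (n := n) (i := 0)
  rcases letter_cases (fibWord (n + 1)) with h | h <;> simpa [h, morphismLetter, eq_comm] using this

theorem fibWord_blockStart_add_one {n : ℕ} (h : fibWord (n + 1) = 0) :
    fibWord (blockStart n + 1 + 1) = 1 := by
  have := fibWord_block (n := n) (i := 1)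
  simpa [h, morphismLetter, eq_comm] using this

theorem fibWord_blockStart_add_one_of_one {n : ℕ} (h : fibWord (n + 1) = 1) :
    fibWord (blockStart n + 1 + 1) = 0 := by
  rw [← blockStart_succ_of_one h, fibWord_blockStart]

theorem exists_blockStart (k : ℕ) :
    ∃ i, k = blockStart i ∨ k = blockStart i + 1 ∧ fibWord (i + 1) = 0 := by
  induction k with
  | zero => exact ⟨0, Or.inl (by simp [blockStart, zeros])⟩
  | succ k ih =>
    obtain ⟨i, rfl | ⟨rfl, h⟩⟩ := ih
    · rcases letter_cases (fibWord (i + 1)) with h | h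
      · exact ⟨i, Or.inr ⟨rfl, h⟩⟩
      · exact ⟨i + 1, Or.inl (blockStart_succ_of_one h).symm⟩
    · exact ⟨i + 1, Or.inl (blockStart_succ_of_zero h).symm⟩

theorem exists_blockStart_of_zero {k : ℕ} (h : fibWord (k + 1) = 0) : ∃ i, k = blockStart i := by
  obtain ⟨i, rfl | ⟨rfl, h'⟩⟩ := exists_blockStart k
  · exact ⟨i, rfl⟩
  · rw [fibWord_blockStart_add_one h'] at h
    exact absurd h (by decide)

theorem exists_blockStart_of_one {k : ℕ} (h : fibWord (k + 1) = 1) :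
    ∃ i, k = blockStart i + 1 ∧ fibWord (i + 1) = 0 := by
  obtain ⟨i, rfl | h'⟩ := exists_blockStart k
  · rw [fibWord_blockStart] at h
    exact absurd h (by decide)
  · exact ⟨i, h'⟩

theorem strictMono_blockStart : StrictMono blockStart := by
  refine strictMono_nat_of_lt_succ fun n => ?_
  rcases letter_cases (fibWord (n + 1)) with h | h
  · rw [blockStart_succ_of_zero h]; omega
  · rw [blockStart_succ_of_one h]; omega

theorem zeros_blockStart_add_one (n : ℕ) : zeros (blockStart n + 1) = zeros (blockStart n) + 1 :=
  zeros_succ_of_zero (fibWord_blockStart n)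

/-- Each block, `01` or `0`, contains exactly one zero. -/
theorem zeros_blockStart (n : ℕ) : zeros (blockStart n) = n := by
  induction n with
  | zero => simp [blockStart, zeros]
  | succ n ih =>
    have h1 := zeros_blockStart_add_one n
    rcases letter_cases (fibWord (n + 1)) with h | h
    · rw [blockStart_succ_of_zero h, zeros_succ_of_one (fibWord_blockStart_add_one h), h1, ih]
    · rw [blockStart_succ_of_one h, h1, ih]

theorem zeros_one : zeros 1 = 1 := by decide

theorem zeros_two : zeros 2 = 1 := by decide

/-- The number of zeros among the first `n` letters, as a Beatty sequence. -/
theorem floor_mul_goldenRatio (n : ℕ) :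
    ⌊((n + 1 : ℕ) : ℝ) * Real.goldenRatio⌋ = (n : ℤ) + 1 + zeros n := by
  have hφ1 := Real.one_lt_goldenRatio
  have hφ2 := Real.goldenRatio_lt_two
  have hsq := Real.goldenRatio_sq
  induction n using Nat.strong_induction_on with
  | _ n ih =>
    rcases Nat.eq_zero_or_pos n with rfl | hn
    · rw [Int.floor_eq_iff]
      simp only [zeros, Nat.count_zero]
      push_cast
      constructor <;> linarith
    · obtain ⟨i, hi⟩ := exists_blockStart n
      have hlt : i < n := by
        have hz : i = 0 ∨ 0 < zeros i := by
          rcases Nat.eq_zero_or_pos i with h | h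
          · exact Or.inl h
          · have : zeros 1 ≤ zeros i := Nat.count_monotone _ h
            rw [zeros_one] at this
            exact Or.inr this
        unfold blockStart at hi
        omega
      have hf := ih i hlt
      have hb : (blockStart i : ℝ) = i + zeros i := by simp [blockStart]
      -- Irrationality makes the lower floor bound strict; on division by φ it becomes the strict
      -- upper bound for `n = blockStart i`.
      have hne : ((i + 1 : ℕ) : ℝ) * Real.goldenRatio ≠ (blockStart i + 1 : ℕ) :=
        (Real.goldenRatio_irrational.natCast_mul i.succ_ne_zero).ne_nat _
      rw [Int.floor_eq_iff] at hf
      push_cast at hf hne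
      have hlo : (blockStart i : ℝ) + 1 < (i + 1) * Real.goldenRatio :=
        lt_of_le_of_ne (by linarith [hf.1]) hne.symm
      have hhi : (i + 1) * Real.goldenRatio < (blockStart i : ℝ) + 2 := by linarith [hf.2]
      have hψ : 0 < Real.goldenRatio - 1 := by linarith
      -- φ - 1 = 1/φ, so multiplying by it passes from the bounds at `i` to those at `n`.
      have hmul : (i + 1) * Real.goldenRatio * (Real.goldenRatio - 1) = i + 1 := by
        linear_combination (i + 1 : ℝ) * hsq
      have hlo' := mul_lt_mul_of_pos_right hlo hψ
      have hhi' := mul_lt_mul_of_pos_right hhi hψ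
      rw [hmul] at hlo' hhi'
      rw [Int.floor_eq_iff]
      rcases hi with rfl | ⟨rfl, h⟩
      · rw [zeros_blockStart]
        push_cast
        constructor <;> linarith
      · rw [zeros_blockStart_add_one, zeros_blockStart]
        push_cast
        constructor <;> linarith

/-! ### Occurrences and desubstitution -/

theorem factor_succ (k m : ℕ) : factor k (m + 1) = fibWord k :: factor (k + 1) m := by
  simp only [factor, List.range_succ_eq_map, List.map_cons, List.map_map, Nat.add_zero]
  congr 1
  refine List.map_congr_left fun i _ => ?_
  simp only [Function.comp, Nat.succ_eq_add_one]
  congr 1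
  omega

theorem occursAt_nil (k : ℕ) : OccursAt [] (k + 1) := by
  simp [OccursAt, factor]

theorem occursAt_cons (a : Fin 2) (w : List (Fin 2)) (k : ℕ) :
    OccursAt (a :: w) (k + 1) ↔ fibWord (k + 1) = a ∧ OccursAt w (k + 1 + 1) := by
  simp [OccursAt, factor_succ]

/-- A word that occurs at the beginning of a block can be desubstituted. -/
theorem exists_desubstitution (w : List (Fin 2)) {i : ℕ} (hw : OccursAt w (blockStart i + 1)) :
    ∃ v : List (Fin 2), (w = [] ∧ v = [] ∨ v.length < w.length) ∧
      ∀ j, OccursAt w (blockStart j + 1) ↔ OccursAt v (j + 1) := by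
  match w with
  | [] => exact ⟨[], Or.inl ⟨rfl, rfl⟩, fun j => iff_of_true (occursAt_nil _) (occursAt_nil _)⟩
  | 1 :: w =>
    rw [occursAt_cons, fibWord_blockStart] at hw
    exact absurd hw.1 (by decide)
  -- Every block starts with 0, so a final 0 says nothing about the block it opens and is dropped.
  | [0] =>
    refine ⟨[], Or.inr (by simp), fun j => ?_⟩
    rw [occursAt_cons, fibWord_blockStart]
    exact iff_of_true ⟨rfl, occursAt_nil _⟩ (occursAt_nil _)
  | 0 :: 1 :: w =>
    have key : ∀ j, OccursAt (0 :: 1 :: w) (blockStart j + 1) ↔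
        fibWord (j + 1) = 0 ∧ OccursAt w (blockStart (j + 1) + 1) := by
      intro j
      rw [occursAt_cons, occursAt_cons, fibWord_blockStart]
      rcases letter_cases (fibWord (j + 1)) with h | h
      · simp [h, fibWord_blockStart_add_one h, blockStart_succ_of_zero h]
      · simp [h, fibWord_blockStart_add_one_of_one h]
    obtain ⟨v, hv, hv'⟩ := exists_desubstitution w ((key i).1 hw).2
    refine ⟨0 :: v, Or.inr ?_, fun j => ?_⟩
    · rcases hv with ⟨rfl, rfl⟩ | hv
      · simp
      · simp only [List.length_cons]; omega
    · rw [key, occursAt_cons, hv']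
  | 0 :: 0 :: w =>
    have key : ∀ j, OccursAt (0 :: 0 :: w) (blockStart j + 1) ↔
        fibWord (j + 1) = 1 ∧ OccursAt (0 :: w) (blockStart (j + 1) + 1) := by
      intro j
      rw [occursAt_cons, fibWord_blockStart]
      rcases letter_cases (fibWord (j + 1)) with h | h
      · rw [occursAt_cons]
        simp [h, fibWord_blockStart_add_one h]
      · simp [h, blockStart_succ_of_one h]
    -- The second 0 opens the next block, so it stays in the word to be desubstituted.
    obtain ⟨v, hv, hv'⟩ := exists_desubstitution (0 :: w) ((key i).1 hw).2
    refine ⟨1 :: v, Or.inr ?_, fun j => ?_⟩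
    · rcases hv with ⟨h, -⟩ | hv
      · simp at h
      · simp only [List.length_cons] at hv ⊢; omega
    · rw [key, hv', occursAt_cons]
  termination_by w.length

/-! ### Affine enumeration of the occurrences -/

/-- The function `f` is an affine combination of the identity and `zeros`. -/
def IsZerosAffine (f : ℕ → ℕ) : Prop :=
  ∃ a b c : ℤ, ∀ n, (f n : ℤ) = a + b * n + c * zeros n

theorem IsZerosAffine.add {f g : ℕ → ℕ} (hf : IsZerosAffine f) (hg : IsZerosAffine g) :
    IsZerosAffine fun n => f n + g n := by
  obtain ⟨a, b, c, h⟩ := hf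
  obtain ⟨a', b', c', h'⟩ := hg
  refine ⟨a + a', b + b', c + c', fun n => ?_⟩
  push_cast
  rw [h, h']
  ring

theorem isZerosAffine_const (d : ℕ) : IsZerosAffine fun _ => d :=
  ⟨d, 0, 0, fun n => by ring⟩

/-- The occurrences of `w` are enumerated by a sequence which, together with the numbers of zeros
before its terms, is affine in the index and `zeros`. -/
def HasAffineOccurrences (w : List (Fin 2)) : Prop :=
  ∃ Y : ℕ → ℕ, StrictMono Y ∧ (∀ k, OccursAt w (k + 1) ↔ ∃ n, Y n = k) ∧
    IsZerosAffine Y ∧ IsZerosAffine fun n => zeros (Y n)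

theorem hasAffineOccurrences_nil : HasAffineOccurrences [] :=
  ⟨id, strictMono_id, fun k => iff_of_true (occursAt_nil k) ⟨k, rfl⟩,
    ⟨0, 1, 0, fun n => by simp⟩, ⟨0, 0, 1, fun n => by simp⟩⟩

/-- Composition with `blockStart` sends the pair (`Y`, `zeros ∘ Y`) to (`Y + zeros ∘ Y`, `Y`); this
is why both components are required to be affine. -/
theorem HasAffineOccurrences.of_blockStart {v w : List (Fin 2)} (hv : HasAffineOccurrences v)
    (h : ∀ k, OccursAt w (k + 1) ↔ ∃ i, k = blockStart i ∧ OccursAt v (i + 1)) :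
    HasAffineOccurrences w := by
  obtain ⟨Y, hY, hocc, hA, hZ⟩ := hv
  refine ⟨fun n => blockStart (Y n), strictMono_blockStart.comp hY, fun k => ?_, hA.add hZ, ?_⟩
  · rw [h]
    simp only [hocc]
    constructor
    · rintro ⟨_, rfl, n, rfl⟩
      exact ⟨n, rfl⟩
    · rintro ⟨n, rfl⟩
      exact ⟨_, rfl, n, rfl⟩
  · simpa only [zeros_blockStart] using hA

theorem HasAffineOccurrences.of_blockStart_add_one {v w : List (Fin 2)}
    (hv : HasAffineOccurrences v)
    (h : ∀ k, OccursAt w (k + 1) ↔ ∃ i, k = blockStart i + 1 ∧ OccursAt v (i + 1)) :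
    HasAffineOccurrences w := by
  obtain ⟨Y, hY, hocc, hA, hZ⟩ := hv
  refine ⟨fun n => blockStart (Y n) + 1, (strictMono_blockStart.comp hY).add_const 1, fun k => ?_,
    (hA.add hZ).add (isZerosAffine_const 1), ?_⟩
  · rw [h]
    simp only [hocc]
    constructor
    · rintro ⟨_, rfl, n, rfl⟩
      exact ⟨n, rfl⟩
    · rintro ⟨n, rfl⟩
      exact ⟨_, rfl, n, rfl⟩
  · simpa only [zeros_blockStart_add_one, zeros_blockStart] using hA.add (isZerosAffine_const 1)

theorem occursAt_zero_cons_iff (w : List (Fin 2)) (k : ℕ) :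
    OccursAt (0 :: w) (k + 1) ↔
      ∃ i, k = blockStart i ∧ OccursAt (0 :: w) (blockStart i + 1) := by
  constructor
  · intro h
    obtain ⟨i, rfl⟩ := exists_blockStart_of_zero ((occursAt_cons _ _ _).1 h).1
    exact ⟨i, rfl, h⟩
  · rintro ⟨i, rfl, h⟩
    exact h

theorem occursAt_one_cons_iff (w : List (Fin 2)) (k : ℕ) :
    OccursAt (1 :: w) (k + 1) ↔
      ∃ i, k = blockStart i + 1 ∧ fibWord (i + 1) = 0 ∧
        OccursAt w (blockStart (i + 1) + 1) := by
  rw [occursAt_cons]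
  constructor
  · rintro ⟨h, hw⟩
    obtain ⟨i, rfl, hi⟩ := exists_blockStart_of_one h
    exact ⟨i, rfl, hi, by rwa [blockStart_succ_of_zero hi]⟩
  · rintro ⟨i, rfl, hi, hw⟩
    exact ⟨fibWord_blockStart_add_one hi, by rwa [blockStart_succ_of_zero hi] at hw⟩

/-- Treated apart because `[1]` reduces to `[0]`, which is no shorter. -/
theorem hasAffineOccurrences_singleton_zero : HasAffineOccurrences [0] := by
  refine hasAffineOccurrences_nil.of_blockStart fun k => ?_
  rw [occursAt_zero_cons_iff]
  simp [occursAt_cons, occursAt_nil, fibWord_blockStart]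

theorem hasAffineOccurrences_of_occursAt (w : List (Fin 2)) {k : ℕ} (hw : OccursAt w (k + 1)) :
    HasAffineOccurrences w := by
  match w with
  | [] => exact hasAffineOccurrences_nil
  | 0 :: w =>
    obtain ⟨i, rfl, hi⟩ := (occursAt_zero_cons_iff _ _).1 hw
    obtain ⟨v, hlen, hv⟩ := exists_desubstitution _ hi
    have hlt : v.length < (0 :: w).length := by simpa using hlen
    refine (hasAffineOccurrences_of_occursAt v ((hv i).1 hi)).of_blockStart fun k => ?_
    rw [occursAt_zero_cons_iff]
    simp only [hv]
  | 1 :: w =>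
    obtain ⟨i, rfl, hi, hw'⟩ := (occursAt_one_cons_iff _ _).1 hw
    obtain ⟨v, hlen, hv⟩ := exists_desubstitution _ hw'
    have hoc : ∀ j, OccursAt (0 :: v) (j + 1) ↔
        fibWord (j + 1) = 0 ∧ OccursAt w (blockStart (j + 1) + 1) := fun j => by
      rw [occursAt_cons, hv]
    have hA : HasAffineOccurrences (0 :: v) := by
      rcases hlen with ⟨-, rfl⟩ | hlen
      · exact hasAffineOccurrences_singleton_zero
      · exact hasAffineOccurrences_of_occursAt (0 :: v) ((hoc i).2 ⟨hi, hw'⟩)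
    refine hA.of_blockStart_add_one fun k => ?_
    rw [occursAt_one_cons_iff]
    simp only [hoc]
  termination_by w.length
  decreasing_by
    · exact hlt
    · simp only [List.length_cons]; omega

/-- A strictly increasing sequence is determined by its range. -/
theorem position_eq {w : List (Fin 2)} {Y : ℕ → ℕ} (hY : StrictMono Y)
    (h : ∀ k, OccursAt w (k + 1) ↔ ∃ n, Y n = k) (n : ℕ) : position w (n + 1) = Y n + 1 := by
  have hY' : StrictMono fun n => Y n + 1 := hY.add_const 1
  have hr : Set.ofPred (OccursAt w) = Set.range fun n => Y n + 1 := by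
    ext k
    cases k with
    | zero => simp [OccursAt]
    | succ k => simp [h]
  have hinf : (Set.ofPred (OccursAt w)).Infinite :=
    hr ▸ Set.infinite_range_of_injective hY'.injective
  have := ((Nat.nth_strictMono hinf).range_inj hY').1 ((Nat.range_nth_of_infinite hinf).trans hr)
  exact congrFun this n

end FibReturn

theorem mainTheorem10 (w : List (Fin 2)) (hw : w ∈ FibReturn.language) :
    {k : ℕ | FibReturn.OccursAt w k}.Infinite ∧
    ∀ l₀ l₁ l₂ : ℤ,
      l₀ = (FibReturn.returnWord w 0).length →
      l₁ = (FibReturn.returnWord w 1).length →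
      l₂ = (FibReturn.returnWord w 2).length →
      FibReturn.IsGeneralizedBeatty Real.goldenRatio (l₁ - l₂) (2 * l₂ - l₁) (l₀ + 1 - l₂)
        (fun n => (FibReturn.position w n : ℤ)) := by
  obtain ⟨k, hk⟩ := hw
  obtain ⟨k, rfl⟩ : ∃ j, k = j + 1 := ⟨k - 1, by have := hk.1; omega⟩
  obtain ⟨Y, hY, hocc, ⟨a, b, c, hA⟩, -⟩ := FibReturn.hasAffineOccurrences_of_occursAt w hk
  have hpos := FibReturn.position_eq hY hocc
  refine ⟨?_, ?_⟩
  · refine Set.infinite_of_injective_forall_mem (f := fun n => Y n + 1)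
      (hY.add_const 1).injective fun n => (hocc _).2 ⟨n, rfl⟩
  · rintro l₀ l₁ l₂ h₀ h₁ h₂ n hn
    obtain ⟨n, rfl⟩ : ∃ j, n = j + 1 := ⟨n - 1, by omega⟩
    have lt01 : Y 0 < Y 1 := hY one_pos
    have lt12 : Y 1 < Y 2 := hY one_lt_two
    simp only [FibReturn.returnWord, FibReturn.factor, List.length_map, List.length_range] at h₀ h₁ h₂
    rw [hpos 0] at h₀ h₁
    rw [hpos 1] at h₁ h₂
    rw [hpos 2] at h₂
    -- As `zeros` is 0, 1, 1 at 0, 1, 2, the first three positions give `a`, `b + c` and `b` as the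
    -- lengths.
    have e0 := hA 0
    have e1 := hA 1
    have e2 := hA 2
    have z0 : FibReturn.zeros 0 = 0 := by simp [FibReturn.zeros]
    rw [z0] at e0
    rw [FibReturn.zeros_one] at e1
    rw [FibReturn.zeros_two] at e2
    push_cast at e0 e1 e2
    have r0 : l₀ = a := by omega
    have r1 : l₁ = b + c := by omega
    have r2 : l₂ = b := by omega
    have hf := FibReturn.floor_mul_goldenRatio n
    rw [hf, r0, r1, r2]
    simp only [hpos]
    push_cast
    rw [hA]
    ring
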